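/- **Theorem.** Let $n\ge 0$ and let $k$ be a field. For a set $E$ of subsets of $\{1,\dots,n\}$ let $I_E$ be the toric ideal of the hypergraph $(\{1,\dots,n\},E)$, i.e. the kernel of the $k$-algebra map $k[t_e : e\in E]\to k[x_1,\dots,x_n]$, $t_e\mapsto\prod_{j\in e}x_j$. An ideal of a polynomial ring is said to be generated by quadrics and cubics if it has a (possibly empty) generating set consisting of (not necessarily homogeneous) polynomials of total degree $2$ or $3$. 1. If $E=\{e\subseteq\{1,\dots,n\} : 2\le |e|\le 3\}$, then $I_E$ is generated by quadrics and cubics. 2. If $E=\{e\subseteq\{1,\dots,n\} : |e|\ge 2\}$, then $I_E$ is generated by quadrics and cubics. 3. Let $\mathrm{Tan}((\mathbb P^1)^n)\subseteq\mathbb P((\mathbb C^2)^{\otimes n})=\mathbb P^{2^n-1}$ be the tangential variety, i.e. the Zariski closure of the union of all projective tangent spaces of the Segre variety $(\mathbb P^1)^n$, with coordinates $p_I$, $I\subseteq\{1,\dots,n\}$ (the $i$-th tensor index is $1$ if $i\in I$ and $0$ if not). On the affine chart $\sum_I p_I=1$, define the moments $\mu_I=\sum_{J\supseteq I}p_J$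 and, for nonempty $I$, the cumulants $$k_I=\sum_{\pi}(-1)^{|\pi|-1}(|\pi|-1)!\prod_{B\in\pi}\mu_B,$$ where $\pi$ runs over the set partitions of $I$. Then the ideal of all polynomials in $\mathbb C[k_I : |I|\ge 2]$ that vanish on the image of $\mathrm{Tan}((\mathbb P^1)^n)\cap\{\sum_I p_I\neq 0\}$ under $p\mapsto (k_I)_{|I|\ge 2}$ (where points are normalized to $\sum_I p_I=1$) is generated by quadrics and cubics. -/

import Mathlib

noncomputable section

namespace CumulantHypergraph

open MvPolynomial

/-! ## Toric ideals of hypergraphs -/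

/-- The toric ideal of the (simple) hypergraph with vertex set `V` and edge set `E`: the kernel of
the monomial map `k[t_e : e ∈ E] → k[x_v : v ∈ V]`, `t_e ↦ ∏ v ∈ e, x_v`. -/
def toricIdeal (k : Type*) [Field k] {V : Type*} (E : Set (Finset V)) :
    Ideal (MvPolynomial E k) :=
  RingHom.ker (aeval (fun e : E => ∏ v ∈ e.1, (X v : MvPolynomial V k)) :
    MvPolynomial E k →ₐ[k] MvPolynomial V k)

/-- All subsets of an `n`-element vertex set that have two or three elements. -/
def edgesTwoThree (n : ℕ) : Set (Finset (Fin n)) := {e | 2 ≤ e.card ∧ e.card ≤ 3}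

/-- All subsets of an `n`-element vertex set that have at least two elements. -/
def edgesTwoUp (n : ℕ) : Set (Finset (Fin n)) := {e | 2 ≤ e.card}

/-- The (not necessarily homogeneous) ideal `I` is generated by polynomials of degree two or
three. -/
def GeneratedByQuadricsAndCubics {k σ : Type*} [Field k] (I : Ideal (MvPolynomial σ k)) : Prop :=
  ∃ G : Set (MvPolynomial σ k),
    (∀ g ∈ G, g.totalDegree = 2 ∨ g.totalDegree = 3) ∧ Ideal.span G = I

/-! ## The tangential variety of the Segre variety `(ℙ¹)ⁿ`

A `2 × ⋯ × 2` table is indexed by the subsets `I` of `{1, …, n}`: the entry `p I` is the one whose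
`i`-th index is `1` for `i ∈ I` and `0` for `i ∉ I`. -/

/-- The space of complex `2 × ⋯ × 2` tables, that is, of tensors in `(ℂ²)^{⊗ n}`. -/
abbrev Table (n : ℕ) : Type := Finset (Fin n) → ℂ

/-- The (affine) Segre map: `(v₁, …, vₙ) ↦ v₁ ⊗ ⋯ ⊗ vₙ`. -/
def segre (n : ℕ) (v : Fin n → Fin 2 → ℂ) : Table n :=
  fun I => ∏ i, v i (if i ∈ I then 1 else 0)

/-- The affine cone over the embedded projective tangent space of the Segre variety at the point
`[v₁ ⊗ ⋯ ⊗ vₙ]`: the span of `v₁ ⊗ ⋯ ⊗ vₙ` and of the image of the differential of the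
Segre map. -/
def segreTangentSpace (n : ℕ) (v : Fin n → Fin 2 → ℂ) : Submodule ℂ (Table n) :=
  Submodule.span ℂ {segre n v} ⊔ LinearMap.range (fderiv ℂ (segre n) v).toLinearMap

/-- The union in `ℙ((ℂ²)^{⊗ n})` of all the projective tangent spaces of the Segre variety. -/
def segreTangents (n : ℕ) : Set (Projectivization ℂ (Table n)) :=
  {x | ∃ v : Fin n → Fin 2 → ℂ, (∀ i, v i ≠ 0) ∧ x.submodule ≤ segreTangentSpace n v}

/-- Zariski closure in a projective space: the common zeros of all the homogeneous polynomials
that vanish on `S`. -/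
def projectiveClosure {σ : Type*} (S : Set (Projectivization ℂ (σ → ℂ))) :
    Set (Projectivization ℂ (σ → ℂ)) :=
  {x | ∀ (d : ℕ) (f : MvPolynomial σ ℂ), f.IsHomogeneous d →
    (∀ y ∈ S, eval y.rep f = 0) → eval x.rep f = 0}

/-- The tangential variety `Tan((ℙ¹)ⁿ)`. -/
def tangentialVariety (n : ℕ) : Set (Projectivization ℂ (Table n)) :=
  projectiveClosure (segreTangents n)

/-! ## Cumulants -/

/-- The moment `μ_I = ∑_{J ⊇ I} p_J`, which is the expectation of `∏ i ∈ I, X_i` if `p` is the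
joint distribution of the `{0,1}`-valued random variables `X₁, …, Xₙ`. -/
def moment {n : ℕ} (p : Table n) (I : Finset (Fin n)) : ℂ :=
  ∑ J with I ⊆ J, p J

/-- The cumulant `k_I = ∑_π (-1)^{|π| - 1} (|π| - 1)! ∏_{B ∈ π} μ_B`, where `π` runs over the
set partitions of `I`. It is used for nonempty `I` and for tables whose entries sum to `1`. -/
def cumulant {n : ℕ} (p : Table n) (I : Finset (Fin n)) : ℂ :=
  ∑ π : Finpartition I,
    (-1) ^ (π.parts.card - 1) * ((π.parts.card - 1).factorial : ℂ) * ∏ B ∈ π.parts, moment p B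

/-- The image of `Tan((ℙ¹)ⁿ)` in higher cumulants. A point of `Tan((ℙ¹)ⁿ)` off the hyperplane
`∑ p_I = 0` has a unique representative `p` whose entries sum to `1`, and is sent to the vector of
its cumulants `k_I` with `|I| ≥ 2`. -/
def tangentialCumulants (n : ℕ) : Set (edgesTwoUp n → ℂ) :=
  {κ | ∃ (p : Table n) (hp : p ≠ 0), Projectivization.mk ℂ p hp ∈ tangentialVariety n ∧
    ∑ I, p I = 1 ∧ ∀ I : edgesTwoUp n, κ I = cumulant p I.1}

end CumulantHypergraph

end

/-! A toric ideal is spanned by differences of monomials with the same image. So the two toric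
statements say that any two families of edges covering the same multiset of vertices are connected
by moves of degree two and three. Passing to the quotient by these moves turns this into an equality
of products in a commutative monoid. Three kinds of moves suffice. Trading one vertex against
another between two edges connects families of equally many `r`-sets (`prod_eq_of_exchange`); pairs
and triples are treated together by adding a dummy vertex to each pair (`prod_eq_of_card_eq`). If
the families have different lengths, two triples of the shorter one are replaced by three pairs, a
cubic move (`prod_eq_of_edgesTwoThree`). Larger edges are split into a pair and the rest, a
quadratic move (`exists_edgesTwoThree_prod_eq`). `generated_of_prod_eq` returns to ideals.

For the tangential variety, the moments of a normalized point on a tangent space, when the point of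
tangency is off the hyperplane at infinity, are the squarefree coefficients of `exp(∑ a_j x_j) (1 +
∑ b_j x_j)`. In degree `r ≥ 2` its logarithm has the squarefree coefficients `(-1)^(r-1) (r-1)! ∏
b_j` (`cumulantOf_tangentMoment`). Up to nonzero constants these parametrize the toric variety of
the hypergraph of all edges with at least two elements. The identity theorem and homogenization
carry vanishing from these points to the whole tangential variety
(`mem_vanishingIdeal_tangentialCumulants`), and a diagonal change of variables transfers the
generators. -/

namespace CumulantHypergraph

/-! ### Connecting families of edges by moves of degree two and three. -/

section Combinatorics

variable {V W A : Type*} [CommMonoid A]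

/-- The multiset of vertices covered by a multiset of edges. -/
def vertexMultiset (S : Multiset (Finset V)) : Multiset V := (S.map Finset.val).sum

@[simp] lemma vertexMultiset_zero : vertexMultiset (0 : Multiset (Finset V)) = 0 := rfl

@[simp] lemma vertexMultiset_cons (e : Finset V) (S : Multiset (Finset V)) :
    vertexMultiset (e ::ₘ S) = e.val + vertexMultiset S := by
  simp [vertexMultiset]

@[simp] lemma vertexMultiset_add (S T : Multiset (Finset V)) :
    vertexMultiset (S + T) = vertexMultiset S + vertexMultiset T := by
  simp [vertexMultiset]

lemma count_val [DecidableEq V] (v : V) (e : Finset V) :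
    e.val.count v = if v ∈ e then 1 else 0 :=
  Multiset.count_eq_of_nodup e.nodup

/-- If every edge through `i` also contained `j`, then `j` would be covered at least as often as
`i`. This supplies the partner edge for an exchange. -/
lemma exists_mem_of_count_lt [DecidableEq V] {S : Multiset (Finset V)} {i j : V}
    (h : (vertexMultiset S).count j < (vertexMultiset S).count i) :
    ∃ g ∈ S, i ∈ g ∧ j ∉ g := by
  by_contra! hS
  refine h.not_ge ?_
  clear h
  induction S using Multiset.induction_on with
  | empty => simp
  | cons g S ih =>
    have h1 := ih fun g hg => hS g (Multiset.mem_cons_of_mem hg)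
    have h2 := hS g (Multiset.mem_cons_self g S)
    simp only [vertexMultiset_cons, Multiset.count_add, count_val]
    split_ifs <;> first | omega | (exfalso; tauto)

lemma exchange_val [DecidableEq V] {f g : Finset V} {i j : V}
    (hif : i ∉ f) (hjf : j ∈ f) (hig : i ∈ g) (hjg : j ∉ g) :
    (insert i (f.erase j)).val + (insert j (g.erase i)).val = f.val + g.val := by
  have hij : i ≠ j := by rintro rfl; exact hif hjf
  ext v
  simp only [Multiset.count_add, count_val, Finset.mem_insert, Finset.mem_erase]
  by_cases h1 : v = i
  · subst h1; simp [*]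
  · by_cases h2 : v = j
    · subst h2; simp [*]
    · simp [*]

lemma card_exchange [DecidableEq V] {f : Finset V} {i j : V} (hif : i ∉ f) (hjf : j ∈ f) :
    (insert i (f.erase j)).card = f.card := by
  rw [Finset.card_insert_of_notMem (by simp [hif]), Finset.card_erase_add_one hjf]

/-- Products over families of `r`-subsets that cover the same vertices agree as soon as the
factors satisfy the quadratic exchange relations. -/
theorem prod_eq_of_exchange [DecidableEq W] (r : ℕ) (u : Finset W → A)
    (hu : ∀ f g i j, f.card = r → g.card = r → i ∉ f → j ∈ f → i ∈ g → j ∉ g →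
      u f * u g = u (insert i (f.erase j)) * u (insert j (g.erase i)))
    (N : ℕ) : ∀ S T : Multiset (Finset W), S.card = N → T.card = N →
      (∀ e ∈ S, e.card = r) → (∀ e ∈ T, e.card = r) →
      vertexMultiset S = vertexMultiset T → (S.map u).prod = (T.map u).prod := by
  induction N with
  | zero =>
    intro S T hS hT _ _ _
    rw [Multiset.card_eq_zero.1 hS, Multiset.card_eq_zero.1 hT]
  | succ N ihN =>
    -- Fix one edge of each family and induct on how far they are from being equal; once they
    -- coincide, they are split off and the families get shorter.
    suffices H : ∀ (d : ℕ) (f e : Finset W) (S T : Multiset (Finset W)), r - (f ∩ e).card ≤ d →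
        S.card = N → T.card = N → (∀ g ∈ f ::ₘ S, g.card = r) → (∀ g ∈ e ::ₘ T, g.card = r) →
        vertexMultiset (f ::ₘ S) = vertexMultiset (e ::ₘ T) →
        ((f ::ₘ S).map u).prod = ((e ::ₘ T).map u).prod by
      intro S T hS hT hSr hTr h
      obtain ⟨f, hf⟩ := Multiset.card_pos_iff_exists_mem.1 (show 0 < S.card by omega)
      obtain ⟨e, he⟩ := Multiset.card_pos_iff_exists_mem.1 (show 0 < T.card by omega)
      obtain ⟨S, rfl⟩ := Multiset.exists_cons_of_mem hf
      obtain ⟨T, rfl⟩ := Multiset.exists_cons_of_mem he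
      rw [Multiset.card_cons] at hS hT
      exact H _ f e S T le_rfl (by omega) (by omega) hSr hTr h
    intro d
    induction d with
    | zero =>
      intro f e S T hd hS hT hSr hTr h
      have hf := hSr f (Multiset.mem_cons_self _ _)
      have he := hTr e (Multiset.mem_cons_self _ _)
      have h1 : f ∩ e = f := Finset.eq_of_subset_of_card_le Finset.inter_subset_left (by omega)
      have h2 : f ∩ e = e := Finset.eq_of_subset_of_card_le Finset.inter_subset_right (by omega)
      obtain rfl : f = e := h1.symm.trans h2
      simp only [vertexMultiset_cons, add_right_inj] at h
      simp only [Multiset.map_cons, Multiset.prod_cons]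
      rw [ihN S T hS hT (fun g hg => hSr g (Multiset.mem_cons_of_mem hg))
        (fun g hg => hTr g (Multiset.mem_cons_of_mem hg)) h]
    | succ d ihd =>
      intro f e S T hd hS hT hSr hTr h
      by_cases hfe : r - (f ∩ e).card ≤ d
      · exact ihd f e S T hfe hS hT hSr hTr h
      have hf := hSr f (Multiset.mem_cons_self _ _)
      have he := hTr e (Multiset.mem_cons_self _ _)
      obtain ⟨j, hj⟩ : (f \ e).Nonempty := by
        rw [← Finset.card_pos, Finset.card_sdiff, Finset.inter_comm]; omega
      obtain ⟨i, hi⟩ : (e \ f).Nonempty := by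
        rw [← Finset.card_pos, Finset.card_sdiff]; omega
      rw [Finset.mem_sdiff] at hi hj
      -- Both families cover the same vertices, so swapping them together with `i` and `j` reverses
      -- the comparison. As `f` contains `j` but not `i`, the inequality becomes strict once `f` is
      -- removed.
      wlog hij : (vertexMultiset (f ::ₘ S)).count j ≤ (vertexMultiset (f ::ₘ S)).count i
        generalizing f e S T i j
      · rw [Finset.inter_comm] at hd hfe
        exact (this e f T S hd hT hS hTr hSr h.symm hfe he hf i hi j hj (by rw [← h]; omega)).symm
      have hlt : (vertexMultiset S).count j < (vertexMultiset S).count i := by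
        simp only [vertexMultiset_cons, Multiset.count_add, count_val, hi.2, hj.1, if_true,
          if_false] at hij
        omega
      obtain ⟨g, hg, hig, hjg⟩ := exists_mem_of_count_lt hlt
      obtain ⟨S, rfl⟩ := Multiset.exists_cons_of_mem hg
      have hgr := hSr g (by simp)
      have hcf := card_exchange hi.2 hj.1
      have hcg := card_exchange hjg hig
      -- The exchange moves `i` into `f` and `j` out of it, so the intersection with `e` gains
      -- exactly one vertex.
      have key := ihd (insert i (f.erase j)) e (insert j (g.erase i) ::ₘ S) T ?_ (by simpa using hS)
        hT ?_ hTr ?_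
      · rw [← key]
        simp only [Multiset.map_cons, Multiset.prod_cons]
        rw [← mul_assoc, ← mul_assoc, hu f g i j hf hgr hi.2 hj.1 hig hjg]
      · have : insert i (f.erase j) ∩ e = insert i (f ∩ e) := by
          ext v
          simp only [Finset.mem_inter, Finset.mem_insert, Finset.mem_erase]
          constructor
          · tauto
          · rintro (rfl | hv)
            · exact ⟨Or.inl rfl, hi.1⟩
            · exact ⟨Or.inr ⟨fun h => hj.2 (h ▸ hv.2), hv.1⟩, hv.2⟩
        rw [this, Finset.card_insert_of_notMem (by simp [hi.2])]
        omega
      · intro g' hg'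
        simp only [Multiset.mem_cons] at hg'
        rcases hg' with rfl | rfl | hg'
        · omega
        · omega
        · exact hSr g' (by simp [hg'])
      · rw [← h]
        simp only [vertexMultiset_cons, ← add_assoc]
        rw [exchange_val hi.2 hj.1 hig hjg]

/-- The function `u` on the edge set `E` satisfies all the relations of degree two and three that
the monomial map of the hypergraph `E` satisfies. -/
def SatisfiesLowDegreeRelations (E : Set (Finset V)) (u : Finset V → A) : Prop :=
  ∀ S T : Multiset (Finset V), (∀ e ∈ S, e ∈ E) → (∀ e ∈ T, e ∈ E) →
    (S.card = 2 ∨ S.card = 3) → T.card ≤ 3 → vertexMultiset S = vertexMultiset T →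
    (S.map u).prod = (T.map u).prod

/-- An edge with two or three elements, completed to a three-element set by `none`. -/
def completeEdge (e : Finset V) : Finset (Option V) :=
  if e.card = 2 then e.insertNone else e.map Function.Embedding.some

lemma eraseNone_completeEdge [DecidableEq V] (e : Finset V) :
    (completeEdge e).eraseNone = e := by
  unfold completeEdge
  split_ifs <;> simp

lemma card_completeEdge {e : Finset V} (he : 2 ≤ e.card ∧ e.card ≤ 3) :
    (completeEdge e).card = 3 := by
  unfold completeEdge
  split_ifs with h
  · simp [h]
  · rw [Finset.card_map]; omega

lemma card_vertexMultiset (S : Multiset (Finset V)) :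
    (vertexMultiset S).card = (S.map Finset.card).sum := by
  induction S using Multiset.induction_on with
  | empty => simp
  | cons e S ih => simp [ih]

/-- Every completed edge has three elements. Hence the multiplicity of the dummy vertex depends only
on the number of edges and the number of covered vertices. -/
lemma count_none_add_card [DecidableEq V] (S : Multiset (Finset V))
    (hS : ∀ e ∈ S, 2 ≤ e.card ∧ e.card ≤ 3) :
    (vertexMultiset (S.map completeEdge)).count none + (vertexMultiset S).card = 3 * S.card := by
  induction S using Multiset.induction_on with
  | empty => simp
  | cons e S ih =>
    have h1 := ih fun g hg => hS g (Multiset.mem_cons_of_mem hg)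
    have h2 := hS e (Multiset.mem_cons_self e S)
    have h3 : (none : Option V) ∈ completeEdge e ↔ e.card = 2 := by
      unfold completeEdge
      split_ifs with h <;> simp [h]
    simp only [Multiset.map_cons, vertexMultiset_cons, Multiset.count_add, count_val,
      Multiset.card_add, Multiset.card_cons, h3, Finset.card_val]
    split_ifs <;> omega

lemma count_some_completeEdge [DecidableEq V] (S : Multiset (Finset V)) (v : V) :
    (vertexMultiset (S.map completeEdge)).count (some v) = (vertexMultiset S).count v := by
  induction S using Multiset.induction_on with
  | empty => simp
  | cons e S ih =>
    have h3 : some v ∈ completeEdge e ↔ v ∈ e := by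
      unfold completeEdge
      split_ifs with h <;> simp
    simp only [Multiset.map_cons, vertexMultiset_cons, Multiset.count_add, count_val, ih, h3]

lemma eraseNone_card_bounds [DecidableEq V] {s : Finset (Option V)} (hs : s.card = 3) :
    2 ≤ s.eraseNone.card ∧ s.eraseNone.card ≤ 3 := by
  have h := congrArg Finset.card (Finset.map_some_eraseNone s)
  rw [Finset.card_map] at h
  have h1 := Finset.pred_card_le_card_erase (s := s) (a := none)
  have h2 := Finset.card_erase_le (s := s) (a := none)
  omega

/-- After completion both families consist of triples and cover the dummy vertex equally often. An
exchange of triples in `Option V` becomes a quadratic relation among pairs and triples once `none`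
is erased. -/
lemma prod_eq_of_card_eq [DecidableEq V] {u : Finset V → A}
    (hu : SatisfiesLowDegreeRelations {e : Finset V | 2 ≤ e.card ∧ e.card ≤ 3} u)
    {S T : Multiset (Finset V)} (hS : ∀ e ∈ S, 2 ≤ e.card ∧ e.card ≤ 3)
    (hT : ∀ e ∈ T, 2 ≤ e.card ∧ e.card ≤ 3) (hc : S.card = T.card)
    (h : vertexMultiset S = vertexMultiset T) : (S.map u).prod = (T.map u).prod := by
  have key := prod_eq_of_exchange 3 (fun s : Finset (Option V) => u s.eraseNone) ?_ S.card
    (S.map completeEdge) (T.map completeEdge) (by simp) (by simp [hc])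
    (by simpa using fun e he => card_completeEdge (hS e he))
    (by simpa using fun e he => card_completeEdge (hT e he)) ?_
  · simpa [eraseNone_completeEdge] using key
  · intro f g i j hf hg hif hjf hig hjg
    have hf' := (card_exchange hif hjf).trans hf
    have hg' := (card_exchange hjg hig).trans hg
    have := hu {f.eraseNone, g.eraseNone}
      {(insert i (f.erase j)).eraseNone, (insert j (g.erase i)).eraseNone} ?_ ?_ (by simp)
      (by simp) ?_
    · simpa using this
    · simp [eraseNone_card_bounds hf, eraseNone_card_bounds hg]
    · simp only [Multiset.insert_eq_cons, Multiset.mem_cons, Multiset.mem_singleton]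
      rintro e (rfl | rfl)
      exacts [eraseNone_card_bounds hf', eraseNone_card_bounds hg']
    · ext v
      have := congrArg (Multiset.count (some v)) (exchange_val hif hjf hig hjg)
      simp only [Multiset.count_add, count_val] at this
      simp only [Multiset.insert_eq_cons, ← Multiset.cons_zero, vertexMultiset_cons,
        vertexMultiset_zero, add_zero, Multiset.count_add, count_val, Finset.mem_eraseNone]
      exact this.symm
  · ext (_ | v)
    · have h1 := count_none_add_card S hS
      have h2 := count_none_add_card T hT
      rw [h] at h1
      omega
    · rw [count_some_completeEdge, count_some_completeEdge, h]

/-- With pairs only, the total would be twice the number of edges. Each triple contributes an excess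
of one, so an excess of two requires two triples. -/
lemma exists_two_triples (S : Multiset (Finset V)) (hS : ∀ e ∈ S, 2 ≤ e.card ∧ e.card ≤ 3)
    (h : 2 * S.card + 2 ≤ (vertexMultiset S).card) :
    ∃ e f S', S = e ::ₘ f ::ₘ S' ∧ e.card = 3 ∧ f.card = 3 := by
  classical
  have aux : ∀ S : Multiset (Finset V), (∀ e ∈ S, 2 ≤ e.card ∧ e.card ≤ 3) →
      2 * S.card < (vertexMultiset S).card → ∃ e ∈ S, e.card = 3 := by
    intro S hS h
    by_contra! hne
    rw [card_vertexMultiset] at h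
    have := Multiset.sum_le_card_nsmul (S.map Finset.card) 2 (by
      simp only [Multiset.mem_map, forall_exists_index, and_imp, forall_apply_eq_imp_iff₂]
      intro e he
      have := hS e he
      have := hne e he
      omega)
    simp only [Multiset.card_map, smul_eq_mul] at this
    omega
  obtain ⟨e, he, he3⟩ := aux S hS (by omega)
  obtain ⟨S, rfl⟩ := Multiset.exists_cons_of_mem he
  simp only [Multiset.card_cons, vertexMultiset_cons, Multiset.card_add, Finset.card_val] at h
  obtain ⟨f, hf, hf3⟩ := aux S (fun g hg => hS g (Multiset.mem_cons_of_mem hg)) (by omega)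
  obtain ⟨S, rfl⟩ := Multiset.exists_cons_of_mem hf
  exact ⟨e, f, S, rfl, he3, hf3⟩

lemma exists_three_pairs {e f : Finset V} (he : e.card = 3) (hf : f.card = 3) :
    ∃ x y z : Finset V, x.card = 2 ∧ y.card = 2 ∧ z.card = 2 ∧
      x.val + y.val + z.val = e.val + f.val := by
  classical
  obtain ⟨c, hc⟩ := Finset.card_pos.1 (show 0 < e.card by omega)
  -- The triples may overlap, so `r` is chosen different from `c` to make `{c, r}` a genuine pair.
  obtain ⟨r, hr, hrc⟩ := Finset.exists_mem_ne (show 1 < f.card by omega) c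
  refine ⟨e.erase c, f.erase r, {c, r}, by rw [Finset.card_erase_of_mem hc, he],
    by rw [Finset.card_erase_of_mem hr, hf], Finset.card_pair hrc.symm, ?_⟩
  ext v
  simp only [Multiset.count_add, count_val, Finset.mem_insert, Finset.mem_erase,
    Finset.mem_singleton]
  by_cases h1 : v = c
  · subst h1; simp [hc, hrc.symm]; omega
  · by_cases h2 : v = r
    · subst h2; simp [hr, hrc]
    · simp [*]

/-- Products over families of pairs and triples that cover the same vertices agree as soon as the
factors satisfy the relations of degree two and three. -/
theorem prod_eq_of_edgesTwoThree {u : Finset V → A}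
    (hu : SatisfiesLowDegreeRelations {e : Finset V | 2 ≤ e.card ∧ e.card ≤ 3} u)
    {S T : Multiset (Finset V)} (hS : ∀ e ∈ S, 2 ≤ e.card ∧ e.card ≤ 3)
    (hT : ∀ e ∈ T, 2 ≤ e.card ∧ e.card ≤ 3)
    (h : vertexMultiset S = vertexMultiset T) : (S.map u).prod = (T.map u).prod := by
  classical
  wlog hc : S.card ≤ T.card generalizing S T
  · exact (this hT hS h.symm (by omega)).symm
  obtain ⟨d, hd⟩ := Nat.exists_eq_add_of_le hc
  induction d generalizing S with
  | zero => exact prod_eq_of_card_eq hu hS hT hd.symm h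
  | succ d ih =>
    have hT2 : 2 * T.card ≤ (vertexMultiset T).card := by
      rw [card_vertexMultiset]
      have := Multiset.card_nsmul_le_sum (s := T.map Finset.card) (a := 2)
        (by simpa using fun e he => (hT e he).1)
      simp only [Multiset.card_map, smul_eq_mul] at this
      omega
    obtain ⟨e, f, S, rfl, he, hf⟩ := exists_two_triples S hS (by rw [h]; omega)
    obtain ⟨x, y, z, hx, hy, hz, hxyz⟩ := exists_three_pairs he hf
    simp only [Multiset.card_cons] at hc hd
    have key := @ih (x ::ₘ y ::ₘ z ::ₘ S) ?_ ?_ ?_ ?_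
    · have hq := hu {e, f} {x, y, z} (by simp [he, hf]) (by simp [hx, hy, hz]) (by simp) (by simp)
        (by simpa [vertexMultiset, add_assoc] using hxyz.symm)
      simp only [Multiset.insert_eq_cons, Multiset.map_cons, Multiset.map_singleton,
        Multiset.prod_cons, Multiset.prod_singleton] at hq
      rw [← key]
      simp only [Multiset.map_cons, Multiset.prod_cons]
      rw [← mul_assoc, hq]
      simp only [mul_assoc]
    · simp only [Multiset.mem_cons]
      rintro g (rfl | rfl | rfl | hg)
      any_goals omega
      exact hS g (by simp [hg])
    · rw [← h]
      simp only [vertexMultiset_cons]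
      rw [← add_assoc, ← add_assoc, hxyz, add_assoc]
    · simp only [Multiset.card_cons]; omega
    · simp only [Multiset.card_cons]; omega

lemma SatisfiesLowDegreeRelations.mono {E F : Set (Finset V)} (hEF : E ⊆ F) {u : Finset V → A}
    (hu : SatisfiesLowDegreeRelations F u) : SatisfiesLowDegreeRelations E u :=
  fun S T hS hT => hu S T (fun e he => hEF (hS e he)) (fun e he => hEF (hT e he))

/-- Pairs are peeled off an edge of size at least four by the inhomogeneous quadric `t_f t_(e \ f) -
t_e`; at least two vertices always remain. -/
lemma exists_edgesTwoThree_prod_eq {u : Finset V → A}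
    (hu : SatisfiesLowDegreeRelations {e : Finset V | 2 ≤ e.card} u) (e : Finset V)
    (he : 2 ≤ e.card) : ∃ S : Multiset (Finset V), (∀ f ∈ S, 2 ≤ f.card ∧ f.card ≤ 3) ∧
      vertexMultiset S = e.val ∧ (S.map u).prod = u e := by
  classical
  induction hN : e.card using Nat.strong_induction_on generalizing e with
  | _ N ih =>
    by_cases h3 : e.card ≤ 3
    · exact ⟨{e}, by simp [he, h3], by simp [vertexMultiset], by simp⟩
    obtain ⟨f, hfe, hf⟩ := Finset.exists_subset_card_eq he
    have hc : (e \ f).card = e.card - 2 := by rw [Finset.card_sdiff_of_subset hfe, hf]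
    obtain ⟨S, hS, hSv, hSp⟩ := ih _ (by omega) (e \ f) (by omega) rfl
    have hval : f.val + (e \ f).val = e.val := by
      ext v
      have := @hfe v
      simp only [Multiset.count_add, count_val, Finset.mem_sdiff]
      split_ifs <;> first | rfl | (exfalso; tauto)
    refine ⟨f ::ₘ S, ?_, ?_, ?_⟩
    · simp only [Multiset.mem_cons]
      rintro g (rfl | hg)
      · omega
      · exact hS g hg
    · rw [vertexMultiset_cons, hSv, hval]
    · have := hu {f, e \ f} {e} ?_ (by simpa using he) (by simp) (by simp)
        (by simpa [vertexMultiset] using hval)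
      · simpa [hSp] using this
      · simp only [Multiset.insert_eq_cons, Multiset.mem_cons, Multiset.mem_singleton,
          Set.mem_ofPred_eq]
        rintro g (rfl | rfl) <;> omega

/-- Products over families of edges with at least two elements that cover the same vertices agree
as soon as the factors satisfy the relations of degree two and three. -/
theorem prod_eq_of_edgesTwoUp {u : Finset V → A}
    (hu : SatisfiesLowDegreeRelations {e : Finset V | 2 ≤ e.card} u)
    {S T : Multiset (Finset V)} (hS : ∀ e ∈ S, 2 ≤ e.card) (hT : ∀ e ∈ T, 2 ≤ e.card)
    (h : vertexMultiset S = vertexMultiset T) : (S.map u).prod = (T.map u).prod := by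
  have aux : ∀ S : Multiset (Finset V), (∀ e ∈ S, 2 ≤ e.card) →
      ∃ S' : Multiset (Finset V), (∀ f ∈ S', 2 ≤ f.card ∧ f.card ≤ 3) ∧
        vertexMultiset S' = vertexMultiset S ∧ (S'.map u).prod = (S.map u).prod := by
    intro S hS
    induction S using Multiset.induction_on with
    | empty => exact ⟨0, by simp, rfl, rfl⟩
    | cons e S ih =>
      obtain ⟨S₁, h1, h2, h3⟩ := ih fun g hg => hS g (Multiset.mem_cons_of_mem hg)
      obtain ⟨S₂, h4, h5, h6⟩ :=
        exists_edgesTwoThree_prod_eq hu e (hS e (Multiset.mem_cons_self e S))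
      refine ⟨S₂ + S₁, ?_, by simp [h2, h5], by simp [h3, h6]⟩
      intro f hf
      rcases Multiset.mem_add.1 hf with hf | hf
      exacts [h4 f hf, h1 f hf]
  obtain ⟨S', h1, h2, h3⟩ := aux S hS
  obtain ⟨T', h4, h5, h6⟩ := aux T hT
  rw [← h3, ← h6]
  exact prod_eq_of_edgesTwoThree (hu.mono fun e he => he.1) h1 h4 (by rw [h2, h5, h])

end Combinatorics

end CumulantHypergraph

noncomputable section
namespace CumulantHypergraph

open MvPolynomial

/-! ### From equalities of products to generators of the toric ideal. -/

section ToricIdeal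

variable {k V : Type*} [Field k] {E : Set (Finset V)}

/-- The monomial map of a hypergraph. -/
def edgeMap (k : Type*) [Field k] {V : Type*} (E : Set (Finset V)) :
    MvPolynomial E k →ₐ[k] MvPolynomial V k :=
  aeval (fun e : E => ∏ v ∈ e.1, (X v : MvPolynomial V k))

lemma mem_toricIdeal {f : MvPolynomial E k} : f ∈ toricIdeal k E ↔ edgeMap k E f = 0 := Iff.rfl

lemma multiset_prod_X {σ : Type*} [DecidableEq σ] (S : Multiset σ) :
    (S.map (X : σ → MvPolynomial σ k)).prod = monomial (Multiset.toFinsupp S) 1 := by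
  induction S using Multiset.induction_on with
  | empty => simp
  | cons a S ih =>
    rw [Multiset.map_cons, Multiset.prod_cons, ih, X, monomial_mul, ← Multiset.singleton_add,
      map_add, Multiset.toFinsupp_singleton, one_mul]

lemma edgeMap_monomial [DecidableEq V] [DecidableEq E] (S : Multiset E) :
    edgeMap k E (monomial (Multiset.toFinsupp S) 1) =
      monomial (Multiset.toFinsupp (vertexMultiset (S.map Subtype.val))) 1 := by
  rw [← multiset_prod_X, ← multiset_prod_X, map_multiset_prod]
  induction S using Multiset.induction_on with
  | empty => simp
  | cons e S ih =>
    simp only [Multiset.map_cons, Multiset.prod_cons, vertexMultiset_cons, Multiset.map_add,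
      Multiset.prod_add]
    rw [ih]
    congr 1
    exact aeval_X _ _

/-- The polynomials of degree two or three in the toric ideal. -/
def lowDegreeElements (k : Type*) [Field k] {V : Type*} (E : Set (Finset V)) :
    Set (MvPolynomial E k) :=
  {g | g ∈ toricIdeal k E ∧ (g.totalDegree = 2 ∨ g.totalDegree = 3)}

open Classical in
/-- The variable of an edge, modulo the polynomials of degree two or three in the toric ideal. -/
def edgeClass (k : Type*) [Field k] {V : Type*} (E : Set (Finset V)) (e : Finset V) :
    MvPolynomial E k ⧸ Ideal.span (lowDegreeElements k E) :=
  -- The value outside `E` is irrelevant: only products over edges of `E` are compared.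
  if h : e ∈ E then Ideal.Quotient.mk _ (X ⟨e, h⟩) else 1

lemma prod_edgeClass [DecidableEq E] (S : Multiset E) :
    ((S.map Subtype.val).map (edgeClass k E)).prod =
      Ideal.Quotient.mk _ (monomial (Multiset.toFinsupp S) 1) := by
  rw [← multiset_prod_X, map_multiset_prod, Multiset.map_map, Multiset.map_map]
  congr 1
  refine Multiset.map_congr rfl fun e _ => ?_
  simp [edgeClass]

lemma exists_map_val_eq {S : Multiset (Finset V)} (hS : ∀ e ∈ S, e ∈ E) :
    ∃ S' : Multiset E, S'.map Subtype.val = S := by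
  lift S to Multiset E using hS
  exact ⟨S, rfl⟩

lemma edgeClass_satisfies : SatisfiesLowDegreeRelations E (edgeClass k E) := by
  classical
  intro S T hS hT hcS hcT h
  obtain ⟨S, rfl⟩ := exists_map_val_eq hS
  obtain ⟨T, rfl⟩ := exists_map_val_eq hT
  rw [prod_edgeClass, prod_edgeClass]
  by_cases hST : S = T
  · rw [hST]
  rw [Ideal.Quotient.eq]
  refine Ideal.subset_span ⟨?_, ?_⟩
  · rw [mem_toricIdeal, map_sub, edgeMap_monomial, edgeMap_monomial, h, sub_self]
  · have hd : ∀ R : Multiset E, (monomial (Multiset.toFinsupp R) (1 : k)).totalDegree = R.card := by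
      intro R
      rw [totalDegree_monomial _ one_ne_zero]
      exact Multiset.toFinsupp_sum_eq R
    simp only [Multiset.card_map] at hcS hcT
    set p := monomial (Multiset.toFinsupp S) (1 : k) - monomial (Multiset.toFinsupp T) 1 with hp
    have h1 : p.totalDegree ≤ 3 := by
      refine (totalDegree_sub _ _).trans ?_
      rw [hd, hd]
      omega
    -- The monomials are distinct, so the one of degree two or three survives in the difference,
    -- even if the other has lower degree.
    have h2 : S.card ≤ p.totalDegree := by
      have : Multiset.toFinsupp S ∈ p.support := by
        rw [mem_support_iff, hp, coeff_sub, coeff_monomial, coeff_monomial, if_pos rfl, if_neg]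
        · simp
        · exact fun h => hST (Multiset.toFinsupp.injective h).symm
      exact (Multiset.toFinsupp_sum_eq S).symm.trans_le (le_totalDegree this)
    omega

/-- A toric ideal is generated by quadrics and cubics as soon as the relations of degree two and
three identify all the monomials with the same image. -/
theorem generated_of_prod_eq
    (h : ∀ S T : Multiset (Finset V), (∀ e ∈ S, e ∈ E) → (∀ e ∈ T, e ∈ E) →
      vertexMultiset S = vertexMultiset T →
      (S.map (edgeClass k E)).prod = (T.map (edgeClass k E)).prod) :
    GeneratedByQuadricsAndCubics (toricIdeal k E) := by
  classical
  refine ⟨lowDegreeElements k E, fun g hg => hg.2, le_antisymm ?_ ?_⟩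
  · exact Ideal.span_le.2 fun g hg => hg.1
  -- A linear map `ψ` back from `k[x]` to the quotient sends a monomial to the class of any chosen
  -- preimage. By `h` the choice does not matter, so `ψ` composed with the monomial map is the
  -- quotient map, which therefore kills the toric ideal.
  let q (d : V →₀ ℕ) : MvPolynomial E k ⧸ Ideal.span (lowDegreeElements k E) :=
    if hd : ∃ S : Multiset E, Multiset.toFinsupp (vertexMultiset (S.map Subtype.val)) = d then
      Ideal.Quotient.mk _ (monomial (Multiset.toFinsupp hd.choose) 1) else 0
  let ψ : MvPolynomial V k →ₗ[k] MvPolynomial E k ⧸ Ideal.span (lowDegreeElements k E) :=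
    (MvPolynomial.basisMonomials V k).constr k q
  have hψ : ψ ∘ₗ (edgeMap k E).toLinearMap =
      (Ideal.Quotient.mkₐ k (Ideal.span (lowDegreeElements k E))).toLinearMap := by
    refine (MvPolynomial.basisMonomials E k).ext fun m => ?_
    obtain ⟨S, rfl⟩ := Multiset.toFinsupp.surjective m
    have hq : ∀ d, ψ (monomial d 1) = q d := fun d => by
      have := (MvPolynomial.basisMonomials V k).constr_basis k q d
      rwa [coe_basisMonomials] at this
    have hex : ∃ R : Multiset E, Multiset.toFinsupp (vertexMultiset (R.map Subtype.val)) =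
        Multiset.toFinsupp (vertexMultiset (S.map Subtype.val)) := ⟨S, rfl⟩
    have hR := hex.choose_spec
    simp only [coe_basisMonomials, LinearMap.comp_apply, AlgHom.toLinearMap_apply,
      edgeMap_monomial, hq, Ideal.Quotient.mkₐ_eq_mk]
    simp only [q]
    rw [dif_pos hex, ← prod_edgeClass, ← prod_edgeClass]
    refine h _ _ ?_ ?_ (Multiset.toFinsupp.injective hR) <;> simp +contextual
  intro f hf
  rw [← Ideal.Quotient.eq_zero_iff_mem]
  have := LinearMap.congr_fun hψ f
  simp only [LinearMap.comp_apply, AlgHom.toLinearMap_apply, Ideal.Quotient.mkₐ_eq_mk] at this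
  rw [← this, mem_toricIdeal.1 hf, map_zero]

theorem generated_edgesTwoThree (k : Type*) [Field k] (n : ℕ) :
    GeneratedByQuadricsAndCubics (toricIdeal k (edgesTwoThree n)) :=
  generated_of_prod_eq fun _ _ hS hT => prod_eq_of_edgesTwoThree edgeClass_satisfies hS hT

theorem generated_edgesTwoUp (k : Type*) [Field k] (n : ℕ) :
    GeneratedByQuadricsAndCubics (toricIdeal k (edgesTwoUp n)) :=
  generated_of_prod_eq fun _ _ hS hT => prod_eq_of_edgesTwoUp edgeClass_satisfies hS hT

end ToricIdeal

end CumulantHypergraph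

end

noncomputable section
namespace CumulantHypergraph

/-! ### Cumulants of tangent points through the moment–cumulant recursion. -/

section Cumulants

variable {V : Type*} [DecidableEq V]

/-- The coefficient of a partition with `r` blocks in the cumulant formula. -/
def cumulantCoeff (r : ℕ) : ℂ := (-1) ^ (r - 1) * ((r - 1).factorial : ℂ)

lemma cumulantCoeff_succ {r : ℕ} (hr : r ≠ 0) :
    cumulantCoeff (r + 1) = -(r * cumulantCoeff r) := by
  obtain ⟨r, rfl⟩ := Nat.exists_eq_succ_of_ne_zero hr
  simp only [cumulantCoeff, Nat.succ_eq_add_one, Nat.add_sub_cancel, Nat.factorial_succ, pow_succ]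
  push_cast
  ring

lemma cumulantCoeff_ne_zero (r : ℕ) : cumulantCoeff r ≠ 0 :=
  mul_ne_zero (pow_ne_zero _ (by norm_num)) (Nat.cast_ne_zero.2 (Nat.factorial_ne_zero _))

/-- The cumulants of an arbitrary family of moments. -/
def cumulantOf (m : Finset V → ℂ) (I : Finset V) : ℂ :=
  ∑ π : Finpartition I, cumulantCoeff π.parts.card * ∏ B ∈ π.parts, m B

lemma exists_finpartition_erase {I B : Finset V} (σ : Finpartition I) (hB : B ∈ σ.parts) :
    ∃ π : Finpartition (I \ B), π.parts = σ.parts.erase B := by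
  refine ⟨σ.avoid B, ?_⟩
  ext C
  rw [Finpartition.mem_avoid, Finset.mem_erase]
  constructor
  · rintro ⟨D, hD, hDB, rfl⟩
    have hne : D ≠ B := by rintro rfl; exact hDB le_rfl
    have hd : Disjoint D B := σ.disjoint hD hB hne
    rw [hd.sdiff_eq_left]
    exact ⟨hne, hD⟩
  · rintro ⟨hne, hC⟩
    have hd : Disjoint C B := σ.disjoint hC hB hne
    exact ⟨C, hC, fun h => σ.ne_bot hC (hd.eq_bot_of_le h), hd.sdiff_eq_left⟩

lemma card_filter_notMem_parts {I : Finset V} (σ : Finpartition I) {i : V} (hi : i ∈ I) :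
    (σ.parts.filter (i ∉ ·)).card = σ.parts.card - 1 := by
  have : σ.parts.filter (i ∉ ·) = σ.parts.erase (σ.part i) := by
    ext B
    rw [Finset.mem_filter, Finset.mem_erase]
    constructor
    · rintro ⟨hB, hiB⟩
      exact ⟨fun h => hiB (h ▸ (σ.mem_part_self.2 hi)), hB⟩
    · rintro ⟨hne, hB⟩
      exact ⟨hB, fun h => hne (σ.part_eq_of_mem hB h).symm⟩
  rw [this, Finset.card_erase_of_mem (σ.part_mem.2 hi)]

/-- Adjoining the block `I \ A` to a partition of `A` gives a partition of `I` with a marked block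
avoiding `i`; removing the marked block is the inverse. -/
lemma sum_finpartition_distinguished {I : Finset V} {i : V} (hi : i ∈ I)
    (F : Finset (Finset V) → ℂ) :
    ∑ A ∈ I.powerset.filter (fun A => i ∈ A ∧ A ≠ I), ∑ π : Finpartition A,
        F (insert (I \ A) π.parts) =
      ∑ σ : Finpartition I, ∑ B ∈ σ.parts with i ∉ B, F σ.parts := by
  rw [Finset.sum_sigma', Finset.sum_sigma']
  have hne : ∀ x ∈ (I.powerset.filter (fun A => i ∈ A ∧ A ≠ I)).sigma
      (fun A => (Finset.univ : Finset (Finpartition A))), I \ x.1 ≠ ⊥ ∧ x.1 ⊆ I ∧ i ∈ x.1 := by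
    rintro ⟨A, π⟩ hx
    simp only [Finset.mem_sigma, Finset.mem_filter, Finset.mem_powerset] at hx
    refine ⟨fun h => hx.1.2.2 (hx.1.1.antisymm ?_), hx.1.1, hx.1.2.1⟩
    exact Finset.sdiff_eq_empty_iff_subset.1 h
  have hnot : ∀ x ∈ (I.powerset.filter (fun A => i ∈ A ∧ A ≠ I)).sigma
      (fun A => (Finset.univ : Finset (Finpartition A))), I \ x.1 ∉ x.2.parts := by
    intro x hx h
    refine (hne x hx).1 (disjoint_self.1 ?_)
    exact Finset.disjoint_of_subset_right (x.2.le h) Finset.sdiff_disjoint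
  refine Finset.sum_bij (fun x hx => ⟨x.2.extend (hne x hx).1 Finset.disjoint_sdiff
    (Finset.union_sdiff_of_subset (hne x hx).2.1), I \ x.1⟩) ?_ ?_ ?_ ?_
  · intro x hx
    simp only [Finset.mem_sigma, Finset.mem_univ, true_and, Finset.mem_filter,
      Finpartition.extend_parts, Finset.mem_insert, true_or, Finset.mem_sdiff, not_and, not_not]
    exact fun _ => (hne x hx).2.2
  · intro x hx y hy hxy
    rw [Sigma.ext_iff] at hxy
    obtain ⟨h1, h2⟩ := hxy
    simp only [heq_eq_eq] at h2
    have h3 : x.1 = y.1 := by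
      rw [← Finset.sdiff_sdiff_eq_self (hne x hx).2.1, h2,
        Finset.sdiff_sdiff_eq_self (hne y hy).2.1]
    have h4 := congrArg Finpartition.parts h1
    have nx := hnot x hx
    have ny := hnot y hy
    obtain ⟨A, π⟩ := x
    obtain ⟨A', π'⟩ := y
    dsimp only at h3
    subst h3
    simp only [Finpartition.extend_parts] at h4
    congr 1
    apply Finpartition.ext
    rw [← Finset.erase_insert nx, ← Finset.erase_insert ny]
    exact congrArg (fun s => Finset.erase s (I \ A)) h4
  · rintro ⟨σ, B⟩ hx
    simp only [Finset.mem_sigma, Finset.mem_univ, true_and, Finset.mem_filter] at hx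
    obtain ⟨hB, hiB⟩ := hx
    obtain ⟨π, hπ⟩ := exists_finpartition_erase σ hB
    have hBI : B ⊆ I := σ.le hB
    have hBB : I \ (I \ B) = B := Finset.sdiff_sdiff_eq_self hBI
    have hIB : I \ B ≠ I := by
      intro h
      refine σ.ne_bot hB ((?_ : Disjoint B B).eq_bot_of_le le_rfl)
      exact Finset.disjoint_of_subset_left hBI (h ▸ Finset.sdiff_disjoint)
    refine ⟨⟨I \ B, π⟩, ?_, ?_⟩
    · simp [hi, hiB, hIB]
    · refine Sigma.ext (Finpartition.ext ?_) (heq_of_eq hBB)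
      simp only [Finpartition.extend_parts, hBB, hπ]
      exact Finset.insert_erase hB
  · intro x hx
    rfl

/-- The recursion between moments and cumulants that expresses `∂ᵢ M = M · ∂ᵢ log M`. -/
theorem sum_cumulantOf_mul {m : Finset V → ℂ} (hm : m ∅ = 1) {I : Finset V} {i : V}
    (hi : i ∈ I) :
    ∑ A ∈ I.powerset with i ∈ A, cumulantOf m A * m (I \ A) = m I := by
  have hI : I ≠ ∅ := Finset.ne_empty_of_mem hi
  have hmem : I ∈ I.powerset.filter (i ∈ ·) := by simp [hi]
  have herase : (I.powerset.filter (i ∈ ·)).erase I =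
      I.powerset.filter (fun A => i ∈ A ∧ A ≠ I) := by
    ext A
    simp only [Finset.mem_erase, Finset.mem_filter]
    tauto
  have hterm : ∀ A ∈ I.powerset.filter (fun A => i ∈ A ∧ A ≠ I), cumulantOf m A * m (I \ A) =
      ∑ π : Finpartition A, cumulantCoeff ((insert (I \ A) π.parts).card - 1) *
        ∏ B ∈ insert (I \ A) π.parts, m B := by
    intro A hA
    simp only [Finset.mem_filter, Finset.mem_powerset] at hA
    rw [cumulantOf, Finset.sum_mul]
    refine Finset.sum_congr rfl fun π _ => ?_
    have hnot : I \ A ∉ π.parts := by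
      intro h
      have h0 : I \ A = ∅ :=
        disjoint_self.1 (Finset.disjoint_of_subset_right (π.le h) Finset.sdiff_disjoint)
      exact hA.2.2 (hA.1.antisymm (Finset.sdiff_eq_empty_iff_subset.1 h0))
    rw [Finset.card_insert_of_notMem hnot, Finset.prod_insert hnot, Nat.add_sub_cancel]
    ring
  rw [← Finset.add_sum_erase _ _ hmem, herase, Finset.sum_congr rfl hterm,
    sum_finpartition_distinguished hi
      (fun P => cumulantCoeff (P.card - 1) * ∏ B ∈ P, m B), Finset.sdiff_self, hm, mul_one,
    cumulantOf, ← Finset.sum_add_distrib, Finset.sum_eq_single (Finpartition.indiscrete hI)]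
  · simp only [Finpartition.indiscrete_parts, Finset.sum_const]
    simp [cumulantCoeff, hi]
  -- A partition with `r ≥ 2` blocks has `r - 1` blocks avoiding `i`, so its total coefficient is
  -- `c_r + (r - 1) c_(r-1) = 0`. Only the one-block partition remains.
  · intro σ _ hσ
    simp only [Finset.sum_const, card_filter_notMem_parts σ hi, nsmul_eq_mul]
    have hpos : σ.parts.card ≠ 0 := Finset.card_ne_zero.2 (σ.parts_nonempty hI)
    have hone : σ.parts.card ≠ 1 := by
      intro h
      obtain ⟨B, hB⟩ := Finset.card_eq_one.1 h
      refine hσ (Finpartition.ext ?_)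
      have := σ.biUnion_parts
      rw [hB, Finset.singleton_biUnion, id] at this
      rw [hB, this, Finpartition.indiscrete_parts]
    have := cumulantCoeff_succ (r := σ.parts.card - 1) (by omega)
    rw [show σ.parts.card - 1 + 1 = σ.parts.card by omega] at this
    rw [this]
    ring
  · simp

/-- Since `m ∅ = 1`, the term `A = I` isolates `κ I`, and all other terms involve proper subsets;
the recursion thus determines `κ`. -/
theorem cumulantOf_eq_of_recursion {m κ : Finset V → ℂ} (hm : m ∅ = 1)
    (hκ : ∀ (I : Finset V) (i : V), i ∈ I → ∑ A ∈ I.powerset with i ∈ A, κ A * m (I \ A) = m I)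
    (I : Finset V) (hI : I.Nonempty) : cumulantOf m I = κ I := by
  induction I using Finset.strongInduction with
  | H I ih =>
    obtain ⟨i, hi⟩ := hI
    have h := (sum_cumulantOf_mul hm hi).trans (hκ I i hi).symm
    have hmem : I ∈ I.powerset.filter (i ∈ ·) := by simp [hi]
    rw [← Finset.add_sum_erase _ _ hmem, ← Finset.add_sum_erase _ _ hmem,
      Finset.sum_congr rfl (g := fun A => κ A * m (I \ A))] at h
    · simpa [hm] using h
    · intro A hA
      simp only [Finset.mem_erase, Finset.mem_filter, Finset.mem_powerset] at hA
      rw [ih A (hA.2.1.ssubset_of_ne hA.1) ⟨i, hA.2.2⟩]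

/-- A set containing `i` arises as `insert j A` with `i ∈ A` once for each of its elements `j ≠ i`.
-/
lemma sum_insert_distinguished {I : Finset V} {i : V} (G : Finset V → ℂ) :
    ∑ A ∈ I.powerset with i ∈ A, ∑ j ∈ I \ A, G (insert j A) =
      ∑ A ∈ I.powerset with i ∈ A, ((A.card - 1 : ℕ) : ℂ) * G A := by
  have : ∀ A ∈ I.powerset.filter (i ∈ ·), ((A.card - 1 : ℕ) : ℂ) * G A =
      ∑ j ∈ A.erase i, G A := by
    intro A hA
    rw [Finset.sum_const, Finset.card_erase_of_mem (Finset.mem_filter.1 hA).2, nsmul_eq_mul]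
  rw [Finset.sum_congr rfl this, Finset.sum_sigma', Finset.sum_sigma']
  refine Finset.sum_bij' (fun x _ => ⟨insert x.2 x.1, x.2⟩) (fun x _ => ⟨x.1.erase x.2, x.2⟩)
    ?_ ?_ ?_ ?_ ?_
  · rintro ⟨A, j⟩ h
    simp only [Finset.mem_sigma, Finset.mem_filter, Finset.mem_powerset, Finset.mem_sdiff,
      Finset.mem_insert, Finset.mem_erase, Finset.insert_subset_iff] at h ⊢
    refine ⟨⟨⟨h.2.1, h.1.1⟩, Or.inr h.1.2⟩, ?_, Or.inl trivial⟩
    rintro rfl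
    exact h.2.2 h.1.2
  · rintro ⟨A, j⟩ h
    simp only [Finset.mem_sigma, Finset.mem_filter, Finset.mem_powerset, Finset.mem_sdiff,
      Finset.mem_erase] at h ⊢
    exact ⟨⟨(Finset.erase_subset _ _).trans h.1.1, h.2.1.symm, h.1.2⟩, h.1.1 h.2.2, by simp⟩
  · rintro ⟨A, j⟩ h
    simp only [Finset.mem_sigma, Finset.mem_sdiff] at h
    simp [Finset.erase_insert h.2.2]
  · rintro ⟨A, j⟩ h
    simp only [Finset.mem_sigma, Finset.mem_erase] at h
    simp [Finset.insert_erase h.2.2]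
  · rintro ⟨A, j⟩ h
    rfl

/-- The moments of a normalized point on a tangent space of the Segre variety. -/
def tangentMoment (a b : V → ℂ) (I : Finset V) : ℂ :=
  ∏ j ∈ I, a j + ∑ j ∈ I, b j * ∏ l ∈ I.erase j, a l

/-- The cumulants of a point on a tangent space of the Segre variety are monomials, up to
constants. -/
theorem cumulantOf_tangentMoment (a b : V → ℂ) {I : Finset V} (hI : 2 ≤ I.card) :
    cumulantOf (tangentMoment a b) I = cumulantCoeff I.card * ∏ j ∈ I, b j := by
  have := cumulantOf_eq_of_recursion (m := tangentMoment a b)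
    (κ := fun A => (if A.card = 1 then ∏ j ∈ A, a j else 0) +
      cumulantCoeff A.card * ∏ j ∈ A, b j) (by simp [tangentMoment]) ?_ I
      (Finset.card_pos.1 (by omega))
  · rw [this, if_neg (by omega), zero_add]
  clear! I
  intro I i hi
  have h1 : ∑ A ∈ I.powerset with i ∈ A, (if A.card = 1 then ∏ j ∈ A, a j else 0) *
      tangentMoment a b (I \ A) = a i * tangentMoment a b (I.erase i) := by
    rw [Finset.sum_eq_single {i}]
    · simp [Finset.sdiff_singleton_eq_erase]
    · intro A hA hne
      rw [if_neg, zero_mul]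
      intro h
      obtain ⟨j, rfl⟩ := Finset.card_eq_one.1 h
      simp only [Finset.mem_filter, Finset.mem_singleton] at hA
      exact hne (by rw [hA.2])
    · simp [hi]
  -- `G` is indexed by the enlarged set `insert j A`, hence the coefficient at cardinality minus
  -- one. After reindexing, `cumulantCoeff_succ` cancels every term except `A = {i}`.
  set G : Finset V → ℂ := fun A => cumulantCoeff (A.card - 1) * (∏ j ∈ A, b j) * ∏ j ∈ I \ A, a j
    with hG
  have h2 : ∑ A ∈ I.powerset with i ∈ A, cumulantCoeff A.card * (∏ j ∈ A, b j) *
      tangentMoment a b (I \ A) = ∑ A ∈ I.powerset with i ∈ A,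
        (cumulantCoeff A.card * (∏ j ∈ A, b j) * (∏ j ∈ I \ A, a j) +
          ((A.card - 1 : ℕ) : ℂ) * G A) := by
    rw [Finset.sum_add_distrib, ← sum_insert_distinguished, ← Finset.sum_add_distrib]
    refine Finset.sum_congr rfl fun A hA => ?_
    rw [tangentMoment, mul_add, Finset.mul_sum]
    congr 1
    refine Finset.sum_congr rfl fun j hj => ?_
    have hjA : j ∉ A := (Finset.mem_sdiff.1 hj).2
    simp only [hG, Finset.card_insert_of_notMem hjA, Finset.prod_insert hjA,
      Finset.sdiff_insert, Nat.add_sub_cancel]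
    ring
  have h3 : ∑ A ∈ I.powerset with i ∈ A,
        (cumulantCoeff A.card * (∏ j ∈ A, b j) * (∏ j ∈ I \ A, a j) +
          ((A.card - 1 : ℕ) : ℂ) * G A) = b i * ∏ j ∈ I.erase i, a j := by
    rw [Finset.sum_eq_single {i}]
    · simp [Finset.sdiff_singleton_eq_erase, cumulantCoeff]
    · intro A hA hne
      simp only [Finset.mem_filter, Finset.mem_powerset] at hA
      have hc : A.card - 1 ≠ 0 := by
        intro h
        have : 0 < A.card := Finset.card_pos.2 ⟨i, hA.2⟩
        obtain ⟨j, rfl⟩ := Finset.card_eq_one.1 (show A.card = 1 by omega)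
        exact hne (by rw [Finset.mem_singleton.1 hA.2])
      have := cumulantCoeff_succ hc
      rw [show A.card - 1 + 1 = A.card by omega] at this
      rw [hG, this]
      ring
    · simp [hi]
  simp only [add_mul, Finset.sum_add_distrib]
  rw [h1, h2, h3]
  have h4 : ∀ j ∈ I.erase i, (b j * ∏ l ∈ I.erase j, a l) =
      a i * (b j * ∏ l ∈ (I.erase i).erase j, a l) := by
    intro j hj
    rw [Finset.erase_right_comm, ← Finset.mul_prod_erase (I.erase j) a
      (Finset.mem_erase.2 ⟨(Finset.ne_of_mem_erase hj).symm, hi⟩)]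
    ring
  simp only [tangentMoment]
  rw [← Finset.add_sum_erase I _ hi, Finset.sum_congr rfl h4, ← Finset.mul_sum,
    ← Finset.mul_prod_erase I a hi]
  ring

end Cumulants

end CumulantHypergraph

end

noncomputable section
namespace CumulantHypergraph

open MvPolynomial

/-! ### Tangent spaces of the Segre variety and their moments. -/

section Tangents

variable {n : ℕ}

/-- A point of the tangent space of the affine Segre cone at `v₁ ⊗ ⋯ ⊗ vₙ`. -/
def tangentPoint (c : ℂ) (v w : Fin n → Fin 2 → ℂ) : Table n :=
  fun I => c * segre n v I + ∑ i, segre n (Function.update v i (w i)) I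

lemma segre_update (v w : Fin n → Fin 2 → ℂ) (i : Fin n) (I : Finset (Fin n)) :
    segre n (Function.update v i (w i)) I =
      (∏ j ∈ Finset.univ.erase i, v j (if j ∈ I then 1 else 0)) * w i (if i ∈ I then 1 else 0) := by
  rw [segre, ← Finset.prod_erase_mul _ _ (Finset.mem_univ i), Function.update_self]
  congr 1
  refine Finset.prod_congr rfl fun j hj => ?_
  rw [Function.update_of_ne (Finset.ne_of_mem_erase hj)]

lemma fderiv_segre (v w : Fin n → Fin 2 → ℂ) (I : Finset (Fin n)) :
    fderiv ℂ (segre n) v w I = ∑ i, segre n (Function.update v i (w i)) I := by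
  have hcoord : ∀ I : Finset (Fin n), HasFDerivAt (fun v : Fin n → Fin 2 → ℂ => segre n v I)
      (∑ i, (∏ j ∈ Finset.univ.erase i, v j (if j ∈ I then 1 else 0)) •
        ((ContinuousLinearMap.proj (if i ∈ I then 1 else 0) : (Fin 2 → ℂ) →L[ℂ] ℂ).comp
          (ContinuousLinearMap.proj i : (Fin n → Fin 2 → ℂ) →L[ℂ] (Fin 2 → ℂ)))) v := by
    intro I
    exact HasFDerivAt.finsetProd fun i _ =>
      ((ContinuousLinearMap.proj (if i ∈ I then 1 else 0) : (Fin 2 → ℂ) →L[ℂ] ℂ).comp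
        (ContinuousLinearMap.proj i : (Fin n → Fin 2 → ℂ) →L[ℂ] (Fin 2 → ℂ))).hasFDerivAt
  rw [(hasFDerivAt_pi.2 hcoord : HasFDerivAt (segre n) _ v).fderiv]
  simp [segre_update]

lemma mem_segreTangentSpace {v : Fin n → Fin 2 → ℂ} {p : Table n} :
    p ∈ segreTangentSpace n v ↔ ∃ c w, p = tangentPoint c v w := by
  rw [segreTangentSpace, Submodule.mem_sup]
  constructor
  · rintro ⟨x, hx, y, ⟨w, rfl⟩, rfl⟩
    obtain ⟨c, rfl⟩ := Submodule.mem_span_singleton.1 hx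
    refine ⟨c, w, ?_⟩
    ext I
    simp [tangentPoint, fderiv_segre]
  · rintro ⟨c, w, rfl⟩
    refine ⟨_, Submodule.smul_mem _ c (Submodule.mem_span_singleton_self _), _, ⟨w, rfl⟩, ?_⟩
    ext I
    simp [tangentPoint, fderiv_segre]

/-- Passing from entries to moments acts on each tensor factor separately, so rank-one tensors have
product moments. -/
lemma moment_segre (v : Fin n → Fin 2 → ℂ) (I : Finset (Fin n)) :
    moment (segre n v) I = ∏ i, if i ∈ I then v i 1 else v i 0 + v i 1 := by
  have h : ∀ i, (if i ∈ I then v i 1 else v i 0 + v i 1) =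
      v i 1 + if i ∈ I then 0 else v i 0 := by
    intro i
    split_ifs <;> ring
  simp only [h]
  rw [Finset.prod_add, moment, Finset.sum_filter, Finset.powerset_univ]
  refine Finset.sum_congr rfl fun J _ => ?_
  split_ifs with hIJ
  · rw [segre, ← Finset.prod_mul_prod_compl J, ← Finset.compl_eq_univ_sdiff]
    congr 1
    · exact Finset.prod_congr rfl fun i hi => by rw [if_pos hi]
    · refine Finset.prod_congr rfl fun i hi => ?_
      have hiJ := Finset.mem_compl.1 hi
      rw [if_neg hiJ, if_neg fun h => hiJ (hIJ h)]
  · obtain ⟨i, hiI, hiJ⟩ := Finset.not_subset.1 hIJ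
    rw [Finset.prod_eq_zero (i := i) (s := Finset.univ \ J) (f := fun i => if i ∈ I then 0 else v i 0)
      (by simp [hiJ]) (if_pos hiI), mul_zero]

lemma moment_tangentPoint_eq_add (c : ℂ) (v w : Fin n → Fin 2 → ℂ) (I : Finset (Fin n)) :
    moment (tangentPoint c v w) I =
      c * moment (segre n v) I + ∑ i, moment (segre n (Function.update v i (w i))) I := by
  simp only [moment, tangentPoint, Finset.sum_add_distrib, Finset.mul_sum]
  rw [Finset.sum_comm]

lemma moment_smul (t : ℂ) (p : Table n) (I : Finset (Fin n)) :
    moment (t • p) I = t * moment p I := by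
  simp [moment, Finset.mul_sum]

lemma moment_empty (p : Table n) : moment p ∅ = ∑ I, p I := by
  simp [moment]

lemma cumulant_eq_cumulantOf (p : Table n) (I : Finset (Fin n)) :
    cumulant p I = cumulantOf (moment p) I := rfl

/-- The moments of a point on a tangent space, if the point of tangency is not on the hyperplane
at infinity. -/
theorem exists_moment_tangentPoint (c : ℂ) {v : Fin n → Fin 2 → ℂ} (w : Fin n → Fin 2 → ℂ)
    (hv : ∀ i, v i 0 + v i 1 ≠ 0) (hp : ∑ I, tangentPoint c v w I ≠ 0) :
    ∃ a b : Fin n → ℂ, ∀ I,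
      moment (tangentPoint c v w) I = (∑ J, tangentPoint c v w J) * tangentMoment a b I := by
  -- Each factor is scaled to have coordinate sum one; `W i` is the coordinate sum of the scaled
  -- tangent direction, and its contribution along `v` is moved into the coefficient of the base
  -- point.
  set s : Fin n → ℂ := fun i => v i 0 + v i 1 with hs
  set α : Fin n → ℂ := fun i => v i 1 / s i with hα
  set β : Fin n → ℂ := fun i => w i 1 / s i with hβ
  set W : Fin n → ℂ := fun i => (w i 0 + w i 1) / s i with hW
  have h1 : ∀ I, moment (segre n v) I = (∏ i, s i) * ∏ i ∈ I, α i := by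
    intro I
    rw [moment_segre, ← Finset.prod_ite_mem_eq I α, ← Finset.prod_mul_distrib]
    refine Finset.prod_congr rfl fun i _ => ?_
    split_ifs
    · rw [hα, mul_div_cancel₀ _ (hv i)]
    · rw [mul_one]
  have h2 : ∀ i I, moment (segre n (Function.update v i (w i))) I =
      (∏ j, s j) * if i ∈ I then β i * ∏ j ∈ I.erase i, α j else W i * ∏ j ∈ I, α j := by
    intro i I
    have h3 : (if i ∈ I then β i * ∏ j ∈ I.erase i, α j else W i * ∏ j ∈ I, α j) =
        ∏ j, if j = i then (if i ∈ I then β i else W i) else if j ∈ I then α j else 1 := by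
      have h4 : Finset.univ.erase i ∩ I = I.erase i := by
        ext j
        simp only [Finset.mem_inter, Finset.mem_erase, Finset.mem_univ, and_true]
      rw [← Finset.mul_prod_erase _ _ (Finset.mem_univ i), if_pos rfl,
        Finset.prod_congr rfl fun j hj => if_neg (Finset.ne_of_mem_erase hj),
        _root_.Finset.prod_ite_mem, h4]
      split_ifs with hi
      · rfl
      · rw [Finset.erase_eq_of_notMem hi]
    rw [moment_segre, h3, ← Finset.prod_mul_distrib]
    refine Finset.prod_congr rfl fun j _ => ?_
    by_cases hj : j = i
    · subst hj
      simp only [Function.update_self, if_true]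
      split_ifs
      · rw [hβ, mul_div_cancel₀ _ (hv j)]
      · rw [hW, mul_div_cancel₀ _ (hv j)]
    · simp only [Function.update_of_ne hj, if_neg hj]
      split_ifs
      · rw [hα, mul_div_cancel₀ _ (hv j)]
      · rw [mul_one]
  have h3 : ∀ I, moment (tangentPoint c v w) I = (∏ j, s j) *
      ((c + ∑ i, W i) * ∏ i ∈ I, α i + ∑ i ∈ I, (β i - W i * α i) * ∏ j ∈ I.erase i, α j) := by
    intro I
    have h4 : ∀ i, (if i ∈ I then β i * ∏ j ∈ I.erase i, α j else W i * ∏ j ∈ I, α j) =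
        W i * (∏ j ∈ I, α j) +
          if i ∈ I then (β i - W i * α i) * ∏ j ∈ I.erase i, α j else 0 := by
      intro i
      split_ifs with hi
      · rw [← Finset.mul_prod_erase I α hi]; ring
      · rw [add_zero]
    rw [moment_tangentPoint_eq_add, h1]
    simp only [h2]
    rw [← Finset.mul_sum]
    simp only [h4]
    rw [Finset.sum_add_distrib, ← Finset.sum_mul, Finset.sum_ite_mem, Finset.univ_inter]
    ring
  have h0 := h3 ∅
  rw [moment_empty] at h0
  simp only [Finset.prod_empty, Finset.sum_empty, mul_one, add_zero] at h0
  have hc : c + ∑ i, W i ≠ 0 := by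
    intro h
    rw [h, mul_zero] at h0
    exact hp h0
  refine ⟨α, fun i => (β i - W i * α i) / (c + ∑ i, W i), fun I => ?_⟩
  rw [h3, h0, tangentMoment, mul_assoc, mul_add (c + _), Finset.mul_sum]
  congr 2
  refine Finset.sum_congr rfl fun i _ => ?_
  rw [← mul_assoc, mul_div_cancel₀ _ hc]

lemma analyticAt_tangentPoint (I : Finset (Fin n))
    (x : ℂ × (Fin n → Fin 2 → ℂ) × (Fin n → Fin 2 → ℂ)) :
    AnalyticAt ℂ (fun x : ℂ × (Fin n → Fin 2 → ℂ) × (Fin n → Fin 2 → ℂ) =>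
      tangentPoint x.1 x.2.1 x.2.2 I) x := by
  have hv : ∀ i b, AnalyticAt ℂ
      (fun x : ℂ × (Fin n → Fin 2 → ℂ) × (Fin n → Fin 2 → ℂ) => x.2.1 i b) x := fun i b =>
    ((ContinuousLinearMap.proj b).comp ((ContinuousLinearMap.proj i).comp
      ((ContinuousLinearMap.fst ℂ (Fin n → Fin 2 → ℂ) (Fin n → Fin 2 → ℂ)).comp
        (ContinuousLinearMap.snd ℂ ℂ ((Fin n → Fin 2 → ℂ) × (Fin n → Fin 2 → ℂ)))) :
          (ℂ × (Fin n → Fin 2 → ℂ) × (Fin n → Fin 2 → ℂ)) →L[ℂ] (Fin 2 → ℂ))).analyticAt x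
  have hw : ∀ i b, AnalyticAt ℂ
      (fun x : ℂ × (Fin n → Fin 2 → ℂ) × (Fin n → Fin 2 → ℂ) => x.2.2 i b) x := fun i b =>
    ((ContinuousLinearMap.proj b).comp ((ContinuousLinearMap.proj i).comp
      ((ContinuousLinearMap.snd ℂ (Fin n → Fin 2 → ℂ) (Fin n → Fin 2 → ℂ)).comp
        (ContinuousLinearMap.snd ℂ ℂ ((Fin n → Fin 2 → ℂ) × (Fin n → Fin 2 → ℂ)))) :
          (ℂ × (Fin n → Fin 2 → ℂ) × (Fin n → Fin 2 → ℂ)) →L[ℂ] (Fin 2 → ℂ))).analyticAt x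
  simp only [tangentPoint, segre_update]
  simp only [segre]
  exact (analyticAt_fst.mul (Finset.analyticAt_fun_prod _ fun i _ => hv i _)).add
    (Finset.analyticAt_fun_sum _ fun i _ =>
      (Finset.analyticAt_fun_prod _ fun j _ => hv j _).mul (hw i _))

lemma analyticAt_eval_tangentPoint (F : MvPolynomial (Finset (Fin n)) ℂ)
    (x : ℂ × (Fin n → Fin 2 → ℂ) × (Fin n → Fin 2 → ℂ)) :
    AnalyticAt ℂ (fun x : ℂ × (Fin n → Fin 2 → ℂ) × (Fin n → Fin 2 → ℂ) =>
      eval (tangentPoint x.1 x.2.1 x.2.2) F) x :=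
  AnalyticAt.aeval_mvPolynomial (fun I => analyticAt_tangentPoint I x) F

end Tangents

/-! ### Homogenization with respect to a linear form. -/

section Homogenization

variable {σ : Type*}

lemma eval_smul_of_isHomogeneous {k : Type*} [CommRing k] {F : MvPolynomial σ k} {N : ℕ}
    (hF : F.IsHomogeneous N) (t : k) (p : σ → k) : eval (t • p) F = t ^ N * eval p F := by
  rw [eval_eq, eval_eq, Finset.mul_sum]
  refine Finset.sum_congr rfl fun d hd => ?_
  have hdN : d.degree = N := by
    by_contra h
    exact mem_support_iff.1 hd (hF.coeff_eq_zero h)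
  simp only [Pi.smul_apply, smul_eq_mul, mul_pow, Finset.prod_mul_distrib]
  rw [Finset.prod_pow_eq_pow_sum, ← hdN, Finsupp.degree_apply]
  ring

lemma exists_homogenization {k : Type*} [CommRing k] (g L : MvPolynomial σ k)
    (hL : L.IsHomogeneous 1) :
    ∃ (N : ℕ) (F : MvPolynomial σ k), F.IsHomogeneous N ∧
      ∀ p, eval p L = 1 → eval p F = eval p g := by
  refine ⟨g.totalDegree, ∑ d ∈ Finset.range (g.totalDegree + 1),
    homogeneousComponent d g * L ^ (g.totalDegree - d), ?_, ?_⟩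
  · refine IsHomogeneous.sum _ _ _ fun d hd => ?_
    have h := (homogeneousComponent_isHomogeneous d g).mul (hL.pow (g.totalDegree - d))
    have hd := Finset.mem_range.1 hd
    rwa [one_mul, show d + (g.totalDegree - d) = g.totalDegree by omega] at h
  · intro p hp
    conv_rhs => rw [← sum_homogeneousComponent g]
    simp [map_sum, hp]

end Homogenization

/-! ### The vanishing ideal of the tangential variety in cumulants. -/

section Cumulants

variable {n : ℕ}

/-- The cumulant as a polynomial in the entries of the table. -/
def cumulantPoly (I : Finset (Fin n)) : MvPolynomial (Finset (Fin n)) ℂ :=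
  ∑ π : Finpartition I, C (cumulantCoeff π.parts.card) * ∏ B ∈ π.parts, ∑ J with B ⊆ J, X J

lemma eval_cumulantPoly (p : Table n) (I : Finset (Fin n)) :
    eval p (cumulantPoly I) = cumulant p I := by
  simp [cumulantPoly, cumulant_eq_cumulantOf, cumulantOf, moment, map_sum, map_prod]

/-- The cumulants of the points on the tangent spaces of the Segre variety. -/
def monomialCumulants (b : Fin n → ℂ) (e : edgesTwoUp n) : ℂ :=
  cumulantCoeff e.1.card * ∏ j ∈ e.1, b j

lemma monomialCumulants_mem (b : Fin n → ℂ) : monomialCumulants b ∈ tangentialCumulants n := by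
  -- Tangency at the point mass on `∅` makes all `a_j` zero; the directions `(-b_i, b_i)` have
  -- coordinate sum zero, so the total stays one.
  set v : Fin n → Fin 2 → ℂ := fun _ => ![1, 0] with hv
  set w : Fin n → Fin 2 → ℂ := fun i => ![-b i, b i] with hw
  have hm : ∀ I, moment (tangentPoint 1 v w) I = tangentMoment 0 b I := by
    intro I
    rw [moment_tangentPoint_eq_add, tangentMoment, moment_segre, one_mul,
      ← Finset.prod_ite_mem_eq I]
    congr 1
    · simp [hv]
    · rw [← Finset.sum_ite_mem_eq I]
      refine Finset.sum_congr rfl fun i _ => ?_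
      rw [moment_segre, ← Finset.mul_prod_erase _ _ (Finset.mem_univ i), Function.update_self,
        ← Finset.prod_ite_mem_eq (I.erase i), Finset.prod_congr rfl
          (g := fun j => if j ∈ I.erase i then (0 : Fin n → ℂ) j else 1)]
      · split_ifs with hi
        · rw [← Finset.mul_prod_erase Finset.univ _ (Finset.mem_univ i)]
          simp [hw]
        · simp [hw]
      · intro j hj
        have hji := Finset.ne_of_mem_erase hj
        rw [Function.update_of_ne hji]
        simp [hji, hv]
  have hsum : ∑ I, tangentPoint 1 v w I = 1 := by
    rw [← moment_empty, hm]
    simp [tangentMoment]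
  have hp : tangentPoint 1 v w ≠ 0 := by
    intro h
    simp [h] at hsum
  refine ⟨_, hp, ?_, hsum, ?_⟩
  · intro d f _ hS
    refine hS _ ⟨v, ?_, ?_⟩
    · intro i h
      simpa [hv] using congrFun h 0
    · rw [Projectivization.submodule_mk, Submodule.span_singleton_le_iff_mem]
      exact mem_segreTangentSpace.2 ⟨_, _, rfl⟩
  · intro e
    rw [cumulant_eq_cumulantOf, funext hm, cumulantOf_tangentMoment _ _ e.2]
    rfl

/-- A homogeneous polynomial vanishes on all the tangent spaces of the Segre variety if it vanishes
on the normalized points with monomial cumulants. -/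
lemma eval_tangentPoint_eq_zero {F : MvPolynomial (Finset (Fin n)) ℂ} {N : ℕ}
    (hF : F.IsHomogeneous N)
    (h : ∀ (p : Table n) (a b : Fin n → ℂ), ∑ I, p I = 1 → moment p = tangentMoment a b →
      eval p F = 0) (c : ℂ) (v w : Fin n → Fin 2 → ℂ) : eval (tangentPoint c v w) F = 0 := by
  have hgood : ∀ (c : ℂ) (v w : Fin n → Fin 2 → ℂ), (∀ i, v i 0 + v i 1 ≠ 0) →
      ∑ I, tangentPoint c v w I ≠ 0 → eval (tangentPoint c v w) F = 0 := by
    intro c v w hv hp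
    obtain ⟨a, b, hab⟩ := exists_moment_tangentPoint c w hv hp
    set L := ∑ I, tangentPoint c v w I with hL
    have h1 := h (L⁻¹ • tangentPoint c v w) a b ?_ ?_
    · rw [eval_smul_of_isHomogeneous hF] at h1
      exact (mul_eq_zero.1 h1).resolve_left (pow_ne_zero _ (inv_ne_zero hp))
    · simp only [Pi.smul_apply, smul_eq_mul]
      rw [← Finset.mul_sum, inv_mul_cancel₀ hp]
    · funext I
      rw [moment_smul, hab, inv_mul_cancel_left₀ hp]
  set f : ℂ × (Fin n → Fin 2 → ℂ) × (Fin n → Fin 2 → ℂ) → ℂ :=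
    fun x => eval (tangentPoint x.1 x.2.1 x.2.2) F with hf
  have han : AnalyticOnNhd ℂ f Set.univ := fun x _ => analyticAt_eval_tangentPoint F x
  -- At this base point all the sums that must not vanish equal one, so the good case covers a
  -- neighbourhood; the identity theorem then gives vanishing for all parameters.
  set x₀ : ℂ × (Fin n → Fin 2 → ℂ) × (Fin n → Fin 2 → ℂ) :=
    (1, (fun _ => ![1, 0]), fun _ => 0) with hx₀
  have hev : f =ᶠ[nhds x₀] 0 := by
    have h1 : ∀ᶠ x in nhds x₀, ∀ i, x.2.1 i 0 + x.2.1 i 1 ≠ 0 := by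
      rw [Filter.eventually_all]
      intro i
      refine ContinuousAt.eventually_ne (by fun_prop) ?_
      simp [hx₀]
    have h2 : ∀ᶠ x in nhds x₀, ∑ I, tangentPoint x.1 x.2.1 x.2.2 I ≠ 0 := by
      refine ContinuousAt.eventually_ne
        (tendsto_finsetSum _ fun I _ => (analyticAt_tangentPoint I x₀).continuousAt) ?_
      rw [← moment_empty, moment_tangentPoint_eq_add]
      have : ∀ i : Fin n, moment (segre n (Function.update (fun _ => ![1, 0]) i 0)) ∅ = 0 := by
        intro i
        rw [moment_segre]
        exact Finset.prod_eq_zero (Finset.mem_univ i) (by simp)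
      simp [hx₀, moment_segre, this]
    filter_upwards [h1, h2] with x hx1 hx2
    exact hgood _ _ _ hx1 hx2
  have hzero : f (c, v, w) = 0 :=
    han.eqOn_zero_of_preconnected_of_eventuallyEq_zero isPreconnected_univ (Set.mem_univ x₀)
      hev (Set.mem_univ (c, v, w))
  exact hzero

/-- Vanishing is tested after pulling `f` back to tables and homogenizing by `∑ X I`. The resulting
form vanishes on all tangent spaces, hence on their projective closure, and agrees with the pullback
on normalized tables. -/
theorem mem_vanishingIdeal_tangentialCumulants {f : MvPolynomial (edgesTwoUp n) ℂ} :
    f ∈ vanishingIdeal ℂ (tangentialCumulants n) ↔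
      ∀ b : Fin n → ℂ, eval (monomialCumulants b) f = 0 := by
  rw [mem_vanishingIdeal_iff]
  simp only [aeval_eq_eval]
  refine ⟨fun h b => h _ (monomialCumulants_mem b), ?_⟩
  rintro h κ ⟨p, hp, hmem, hsum, hκ⟩
  have hL : (∑ I, X I : MvPolynomial (Finset (Fin n)) ℂ).IsHomogeneous 1 :=
    IsHomogeneous.sum _ _ _ fun I _ => isHomogeneous_X ℂ I
  obtain ⟨N, F, hF, hFg⟩ :=
    exists_homogenization (bind₁ (fun e : edgesTwoUp n => cumulantPoly e.1) f) _ hL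
  have hval : ∀ q : Table n, ∑ I, q I = 1 →
      eval q F = eval (fun e : edgesTwoUp n => cumulant q e.1) f := by
    intro q hq
    rw [hFg q (by simpa using hq), ← aeval_eq_eval, ← aeval_eq_eval, aeval_bind₁]
    simp only [aeval_eq_eval, eval_cumulantPoly]
  have hzero := eval_tangentPoint_eq_zero hF (by
    intro q a b hq hqm
    rw [hval q hq, ← h b]
    congr 2
    funext e
    rw [cumulant_eq_cumulantOf, hqm, cumulantOf_tangentMoment _ _ e.2]
    rfl)
  have hrep := hmem N F hF (by
    rintro y ⟨v, -, hy⟩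
    rw [Projectivization.submodule_eq, Submodule.span_singleton_le_iff_mem,
      mem_segreTangentSpace] at hy
    obtain ⟨c, w, hy⟩ := hy
    rw [hy]
    exact hzero c v w)
  obtain ⟨a, ha⟩ := Projectivization.exists_smul_eq_mk_rep ℂ p hp
  rw [← ha, Units.smul_def, eval_smul_of_isHomogeneous hF, hval p hsum] at hrep
  rw [funext hκ]
  exact (mul_eq_zero.1 hrep).resolve_left (pow_ne_zero _ a.ne_zero)

end Cumulants

/-! ### Diagonal changes of variables. -/

section Rescaling

variable {k σ : Type*} [Field k]

/-- The diagonal substitution `x_s ↦ c_s x_s`. -/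
def rescale (c : σ → k) : MvPolynomial σ k →ₐ[k] MvPolynomial σ k :=
  aeval fun s => C (c s) * X s

lemma totalDegree_rescale_le (c : σ → k) (f : MvPolynomial σ k) :
    (rescale c f).totalDegree ≤ f.totalDegree := by
  conv_lhs => rw [f.as_sum, map_sum]
  refine totalDegree_finsetSum_le fun m hm => ?_
  refine le_trans ?_ (le_totalDegree hm)
  have : rescale c (monomial m (coeff m f)) =
      monomial m (coeff m f * m.prod fun s e => c s ^ e) := by
    rw [rescale, aeval_monomial, monomial_eq, C_mul, algebraMap_eq, mul_assoc]
    congr 1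
    simp only [mul_pow, Finsupp.prod, Finset.prod_mul_distrib, map_prod, map_pow]
  rw [this]
  exact totalDegree_monomial_le _ _

lemma rescale_rescale {c d : σ → k} (hcd : ∀ s, c s * d s = 1) (f : MvPolynomial σ k) :
    rescale c (rescale d f) = f := by
  have : (rescale c).comp (rescale d) = AlgHom.id k _ := by
    ext1 s
    simp only [rescale, AlgHom.comp_apply, aeval_X, map_mul, algHom_C, algebraMap_eq,
      AlgHom.id_apply]
    rw [← mul_assoc, ← C_mul, mul_comm (d s), hcd, C_1, one_mul]
  exact AlgHom.congr_fun this f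

lemma GeneratedByQuadricsAndCubics.of_rescale {I J : Ideal (MvPolynomial σ k)}
    (hI : GeneratedByQuadricsAndCubics I) {c : σ → k} (hc : ∀ s, c s ≠ 0)
    (hJ : ∀ f, f ∈ J ↔ rescale c f ∈ I) : GeneratedByQuadricsAndCubics J := by
  obtain ⟨G, hG, rfl⟩ := hI
  have h1 := rescale_rescale (c := c) (d := fun s => (c s)⁻¹) fun s => mul_inv_cancel₀ (hc s)
  have h2 := rescale_rescale (c := fun s => (c s)⁻¹) (d := c) fun s => inv_mul_cancel₀ (hc s)
  refine ⟨rescale (fun s => (c s)⁻¹) '' G, ?_, le_antisymm ?_ ?_⟩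
  · rintro _ ⟨g, hg, rfl⟩
    -- Applying the degree bound to the inverse substitution as well shows that the degree is
    -- preserved exactly.
    have h3 := totalDegree_rescale_le c (rescale (fun s => (c s)⁻¹) g)
    rw [h1] at h3
    rw [le_antisymm (totalDegree_rescale_le _ g) h3]
    exact hG g hg
  · rw [Ideal.span_le]
    rintro _ ⟨g, hg, rfl⟩
    rw [SetLike.mem_coe, hJ, h1]
    exact Ideal.subset_span hg
  · intro f hf
    have := Ideal.mem_map_of_mem (rescale fun s => (c s)⁻¹) ((hJ f).1 hf)
    rwa [h2, Ideal.map_span] at this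

end Rescaling

/-- Over an infinite field a polynomial is zero once it vanishes at every point, so the toric ideal
is the vanishing ideal of its parametrized points. -/
lemma mem_toricIdeal_iff_eval {k V : Type*} [Field k] [Infinite k] {E : Set (Finset V)}
    {f : MvPolynomial E k} :
    f ∈ toricIdeal k E ↔ ∀ b : V → k, eval (fun e : E => ∏ v ∈ e.1, b v) f = 0 := by
  have h : ∀ b : V → k, eval b (edgeMap k E f) = eval (fun e : E => ∏ v ∈ e.1, b v) f := by
    intro b
    rw [← aeval_eq_eval, ← aeval_eq_eval,
      ← AlgHom.comp_apply]
    congr 1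
    ext e
    simp [edgeMap]
  rw [mem_toricIdeal]
  constructor
  · intro hf b
    rw [← h, hf, map_zero]
  · intro hf
    refine MvPolynomial.funext fun b => ?_
    rw [h, hf, map_zero]

/-- The constants `(-1)^(r-1) (r-1)!` are nonzero in `ℂ`, so scaling the variables by them
identifies the vanishing ideal with the toric ideal of `edgesTwoUp n`. -/
theorem generated_tangentialCumulants (n : ℕ) :
    GeneratedByQuadricsAndCubics (vanishingIdeal ℂ (tangentialCumulants n)) := by
  refine (generated_edgesTwoUp ℂ n).of_rescale (c := fun e => cumulantCoeff e.1.card)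
    (fun e => cumulantCoeff_ne_zero _) fun f => ?_
  rw [mem_vanishingIdeal_tangentialCumulants, mem_toricIdeal_iff_eval]
  refine forall_congr' fun b => ?_
  have : eval (fun e : edgesTwoUp n => ∏ v ∈ e.1, b v)
      (rescale (fun e : edgesTwoUp n => cumulantCoeff e.1.card) f) =
      eval (monomialCumulants b) f := by
    rw [← aeval_eq_eval, ← aeval_eq_eval,
      ← AlgHom.comp_apply]
    congr 1
    ext e
    simp [rescale, monomialCumulants]
  rw [this]

end CumulantHypergraph

end

theorem mainTheorem2 (k : Type*) [Field k] (n : ℕ) :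
    CumulantHypergraph.GeneratedByQuadricsAndCubics
        (CumulantHypergraph.toricIdeal k (CumulantHypergraph.edgesTwoThree n)) ∧
      CumulantHypergraph.GeneratedByQuadricsAndCubics
        (CumulantHypergraph.toricIdeal k (CumulantHypergraph.edgesTwoUp n)) ∧
      CumulantHypergraph.GeneratedByQuadricsAndCubics
        (MvPolynomial.vanishingIdeal ℂ (CumulantHypergraph.tangentialCumulants n)) :=
  ⟨CumulantHypergraph.generated_edgesTwoThree k n, CumulantHypergraph.generated_edgesTwoUp k n,
    CumulantHypergraph.generated_tangentialCumulants n⟩
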